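/- Let $M>1$, $K_I,K_E\ge 0$ be integers, $P>0$, $0<\zeta\le 1$, $\sigma_i>0$, $\gamma_i>0$ ($1\le i\le K_I$), and $\alpha_j\ge 0$ ($1\le j\le K_E$), not all $\alpha_j$ zero. Let the channel vectors $h_1,\dots,h_{K_I},g_1,\dots,g_{K_E}\in\mathbb C^{1\times M}$ be mutually independent random row vectors, each having a probability density with respect to Lebesgue measure on $\mathbb C^{M}$. Put $G=\zeta\sum_j\alpha_j g_j^Hg_j$. (P1) is the problem of maximizing $\sum_i w_i^HGw_i+\sum_j v_j^HGv_j$ over $w_i,v_j\in\mathbb C^{M}$ subject to $$\frac{|h_iw_i|^2}{\sum_{k\ne i}|h_iw_k|^2+\sum_j|h_iv_j|^2+\sigma_i^2}\ge\gamma_i\quad(\forall i),\qquad \sum_i\|w_i\|^2+\sum_j\|v_j\|^2\le P .$$ Its semidefinite relaxation (SDR1) is the problem of maximizing $\sum_i\operatorname{tr}(GW_i)+\operatorname{tr}(GW_E)$ over $M\times M$ matrices $W_i\succeq0$, $W_E\succeq 0$ subject to $$\frac{\operatorname{tr}(h_i^Hh_iW_i)}{\gamma_i}-\sum_{k\ne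 i}\operatorname{tr}(h_i^Hh_iW_k)-\operatorname{tr}(h_i^Hh_iW_E)-\sigma_i^2\ge 0\quad(\forall i),\qquad \sum_i\operatorname{tr}(W_i)+\operatorname{tr}(W_E)\le P .$$ Call a channel realization OeBF-feasible if for some unit eigenvector $v_E$ of $G$ for its largest eigenvalue there are $p_i\ge 0$ with $\sum_ip_i\le P$ and $\dfrac{p_i|h_iv_E|^2}{\sum_{k\neq i}p_k|h_iv_E|^2+\sigma_i^2}\ge\gamma_i$ for all $i$. Then, with probability one, the following holds: if (SDR1) is feasible and the realization is not OeBF-feasible, then (SDR1) has an optimal solution, and every optimal solution $(\{W_i^\star\},W_E^\star)$ satisfies $\operatorname{rank}(W_i^\star)=1$ for all $i$ and $W_E^\star=0$. Consequently the relaxation is tight and no energy beam is needed: there are $w_i$ with $W_i^\star=w_iw_i^H$ such that $(\{w_i\},\{v_j=0\})$ is an optimal solution of (P1), with the same objective value as $(\{W_i^\star\},W_E^\star)$ in (SDR1). -/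

import Mathlib

open MeasureTheory ProbabilityTheory Matrix
open scoped ComplexOrder

noncomputable section

namespace SWIPT

/-- The deterministic data of the downlink with `KI` information-decoding (ID) receivers and
`KE` energy-harvesting (EH) receivers. -/
structure Params (KI KE : ℕ) where
  /-- transmit sum-power budget -/
  P : ℝ
  /-- energy harvesting efficiency -/
  ζ : ℝ
  /-- standard deviation of the noise at each ID receiver (the noise power is `σ i ^ 2`) -/
  σ : Fin KI → ℝ
  /-- SINR target of each ID receiver -/
  γ : Fin KI → ℝ
  /-- energy weight of each EH receiver -/
  α : Fin KE → ℝ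

variable {M KI KE : ℕ}

/-- Squared Euclidean norm of a complex vector. -/
def sqNorm (w : Fin M → ℂ) : ℝ := ∑ m, ‖w m‖ ^ 2

/-- The `M × M` matrix `hᴴ h` of a row vector `h`. -/
def gram (h : Fin M → ℂ) : Matrix (Fin M) (Fin M) ℂ := vecMulVec (star h) h

/-- The matrix `w wᴴ` of a column vector `w`. -/
def outer (w : Fin M → ℂ) : Matrix (Fin M) (Fin M) ℂ := vecMulVec w (star w)

/-- `G = ζ ∑ⱼ αⱼ gⱼᴴ gⱼ`. -/
def energyMatrix (p : Params KI KE) (g : Fin KE → Fin M → ℂ) : Matrix (Fin M) (Fin M) ℂ :=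
  (p.ζ : ℂ) • ∑ j, (p.α j : ℂ) • gram (g j)

/-! ### The beamforming problem (P1)

A point is a pair of families: information beams `w i` and energy beams `v j`. -/

/-- SINR of the `i`-th ID receiver when the energy signals are not cancelled (Type I). -/
def sinrI (p : Params KI KE) (h : Fin KI → Fin M → ℂ)
    (x : (Fin KI → Fin M → ℂ) × (Fin KE → Fin M → ℂ)) (i : Fin KI) : ℝ :=
  ‖h i ⬝ᵥ x.1 i‖ ^ 2 /
    (∑ k ∈ Finset.univ.erase i, ‖h i ⬝ᵥ x.1 k‖ ^ 2 + ∑ j, ‖h i ⬝ᵥ x.2 j‖ ^ 2 + p.σ i ^ 2)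

/-- Feasible set of (P1). -/
def p1Feasible (p : Params KI KE) (h : Fin KI → Fin M → ℂ) :
    Set ((Fin KI → Fin M → ℂ) × (Fin KE → Fin M → ℂ)) :=
  {x | (∀ i, p.γ i ≤ sinrI p h x i) ∧ ∑ i, sqNorm (x.1 i) + ∑ j, sqNorm (x.2 j) ≤ p.P}

/-- Objective of (P1): the weighted sum of the harvested powers. -/
def p1Objective (p : Params KI KE) (g : Fin KE → Fin M → ℂ)
    (x : (Fin KI → Fin M → ℂ) × (Fin KE → Fin M → ℂ)) : ℝ :=
  ∑ i, (star (x.1 i) ⬝ᵥ energyMatrix p g *ᵥ x.1 i).re +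
    ∑ j, (star (x.2 j) ⬝ᵥ energyMatrix p g *ᵥ x.2 j).re

/-- Global optimality for (P1). -/
def IsP1Optimal (p : Params KI KE) (h : Fin KI → Fin M → ℂ) (g : Fin KE → Fin M → ℂ)
    (x : (Fin KI → Fin M → ℂ) × (Fin KE → Fin M → ℂ)) : Prop :=
  x ∈ p1Feasible p h ∧ IsMaxOn (p1Objective p g) (p1Feasible p h) x

/-! ### The semidefinite relaxation (SDR1)

A point is a family `W i` together with one matrix `W_E`. All traces that occur are real at
feasible points, so taking real parts loses nothing. -/

/-- Feasible set of (SDR1). -/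
def sdr1Feasible (p : Params KI KE) (h : Fin KI → Fin M → ℂ) :
    Set ((Fin KI → Matrix (Fin M) (Fin M) ℂ) × Matrix (Fin M) (Fin M) ℂ) :=
  {X | (∀ i, 0 ≤ (gram (h i) * X.1 i).trace.re / p.γ i
          - ∑ k ∈ Finset.univ.erase i, (gram (h i) * X.1 k).trace.re
          - (gram (h i) * X.2).trace.re - p.σ i ^ 2) ∧
        ∑ i, (X.1 i).trace.re + X.2.trace.re ≤ p.P ∧
        (∀ i, (X.1 i).PosSemidef) ∧ X.2.PosSemidef}

/-- Objective of (SDR1). -/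
def sdr1Objective (p : Params KI KE) (g : Fin KE → Fin M → ℂ)
    (X : (Fin KI → Matrix (Fin M) (Fin M) ℂ) × Matrix (Fin M) (Fin M) ℂ) : ℝ :=
  ∑ i, (energyMatrix p g * X.1 i).trace.re + (energyMatrix p g * X.2).trace.re

/-- Optimality for (SDR1). -/
def IsSDR1Optimal (p : Params KI KE) (h : Fin KI → Fin M → ℂ) (g : Fin KE → Fin M → ℂ)
    (X : (Fin KI → Matrix (Fin M) (Fin M) ℂ) × Matrix (Fin M) (Fin M) ℂ) : Prop :=
  X ∈ sdr1Feasible p h ∧ IsMaxOn (sdr1Objective p g) (sdr1Feasible p h) X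

/-! ### The degenerate case: all information beams along the optimal energy beamformer -/

/-- `v` is a unit eigenvector of `G` for its largest eigenvalue. -/
def IsDominantEigenvector (G : Matrix (Fin M) (Fin M) ℂ) (v : Fin M → ℂ) : Prop :=
  sqNorm v = 1 ∧ ∃ ξ : ℝ, G *ᵥ v = (ξ : ℂ) • v ∧
    ∀ μ : ℝ, Module.End.HasEigenvalue (Matrix.toLin' G) (μ : ℂ) → μ ≤ ξ

/-- Aligning all information beams with a dominant eigenvector `v` of `G`, that is
`w i = √(q i) • v` with suitable powers `q i`, meets all SINR targets within the budget. -/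
def OeBFFeasible (p : Params KI KE) (h : Fin KI → Fin M → ℂ) (g : Fin KE → Fin M → ℂ) : Prop :=
  ∃ v : Fin M → ℂ, IsDominantEigenvector (energyMatrix p g) v ∧
    ∃ q : Fin KI → ℝ, (∀ i, 0 ≤ q i) ∧
      (∀ i, p.γ i ≤ q i * ‖h i ⬝ᵥ v‖ ^ 2 /
        (∑ k ∈ Finset.univ.erase i, q k * ‖h i ⬝ᵥ v‖ ^ 2 + p.σ i ^ 2)) ∧
      ∑ i, q i ≤ p.P

/-! ### Random channels -/

/-- All channel vectors are mutually independent, and each has a continuous distribution on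
`ℂ^M`, i.e. a probability density with respect to Lebesgue measure. (Almost sure linear
independence of any at most `M` channel vectors, and distinctness of the singular values of the
matrix they form, are consequences.) -/
structure IndependentChannels {Ω : Type*} [MeasurableSpace Ω] (μ : Measure Ω)
    (h : Fin KI → Ω → Fin M → ℂ) (g : Fin KE → Ω → Fin M → ℂ) : Prop where
  measurable_h : ∀ i, Measurable (h i)
  measurable_g : ∀ j, Measurable (g j)
  indep : iIndepFun (Sum.elim h g) μ
  density_h : ∀ i, HasPDF (h i) μ volume
  density_g : ∀ j, HasPDF (g j) μ volume

end SWIPT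

end

/-! At an optimum of the relaxation, Fritz John multipliers `c` (objective), `β` (power) and `l i`
(SINR) give positive semidefinite slacks `E = β I + ∑ l k hₖᴴhₖ - c G` and `E - l i (1/γ i + 1)
hᵢᴴhᵢ`, with `E W_E = 0` and `(E - l i (1/γ i + 1) hᵢᴴhᵢ) Wᵢ = 0` (`exists_multipliers`). If `E` is
invertible, then `W_E = 0` and `Wᵢ` is a multiple of `E⁻¹ hᵢᴴ (hᵢ Wᵢ)`, of rank at most one; the
noise forces `Wᵢ ≠ 0`.

It remains to exclude a singular `E`. First, `β > 0`: otherwise the value identity kills every `l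
i`, and `-c G ⪰ 0` with `c > 0` contradicts `G ≠ 0`. If `E x = 0`, the information slacks force `hᵢ
x = 0` whenever `l i > 0`, so `β x = c G x`. Thus for `x ≠ 0` some `hᵢ` annihilates an eigenvector
of `G` with nonzero eigenvalue, a null event, unless all `l i` vanish while `c > 0`. In that last
case all `Wᵢ` live on the top eigenspace of `G`, almost surely a line, which is exactly
OeBF-feasibility (`oeBFFeasible_of_multipliers`).

Genericity is proved by adding the rank-one terms of `G` one at a time. If the nonzero spectrum of
`A` is simple, the row vectors killing an eigenvector lie in finitely many hyperplanes; adding the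
term of any other row keeps the spectrum simple. Independence and Fubini turn this into an almost
sure statement. -/

namespace SWIPT

variable {M : ℕ}

/-! ### Generic position of a matrix and a row vector -/

/-- Every eigenspace of `A` for a nonzero eigenvalue is at most one-dimensional. -/
def SimpleNonzeroSpectrum (A : Matrix (Fin M) (Fin M) ℂ) : Prop :=
  ∀ β : ℂ, β ≠ 0 → ∀ x y : Fin M → ℂ, x ≠ 0 → A *ᵥ x = β • x → A *ᵥ y = β • y → ∃ c : ℂ, y = c • x

/-- The row vector `h` annihilates some eigenvector of `A` for a nonzero eigenvalue. -/
def KillsEigenvector (A : Matrix (Fin M) (Fin M) ℂ) (h : Fin M → ℂ) : Prop :=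
  ∃ β : ℂ, β ≠ 0 ∧ ∃ x : Fin M → ℂ, x ≠ 0 ∧ A *ᵥ x = β • x ∧ h ⬝ᵥ x = 0

lemma gram_mulVec (h x : Fin M → ℂ) : gram h *ᵥ x = (h ⬝ᵥ x) • star h := by
  simp [gram, vecMulVec_mulVec]

/-- On the kernel of `h` the perturbed matrix agrees with `A`, so `h` is injective on each
eigenspace with nonzero eigenvalue. Such an eigenspace embeds in `ℂ`. -/
lemma simpleNonzeroSpectrum_add_gram {A : Matrix (Fin M) (Fin M) ℂ} {h : Fin M → ℂ}
    (hA : ¬ KillsEigenvector A h) (c : ℂ) : SimpleNonzeroSpectrum (A + c • gram h) := by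
  intro β hβ x y hx hxA hyA
  have key : ∀ z : Fin M → ℂ, (A + c • gram h) *ᵥ z = β • z → h ⬝ᵥ z = 0 → z = 0 := by
    intro z hz hhz
    by_contra hz0
    refine hA ⟨β, hβ, z, hz0, ?_, hhz⟩
    rw [add_mulVec, smul_mulVec, gram_mulVec, hhz] at hz
    simpa using hz
  have hx0 : h ⬝ᵥ x ≠ 0 := fun h0 => hx (key x hxA h0)
  refine ⟨(h ⬝ᵥ y) / (h ⬝ᵥ x), ?_⟩
  have := key (y - ((h ⬝ᵥ y) / (h ⬝ᵥ x)) • x)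
    (by rw [mulVec_sub, mulVec_smul, hxA, hyA, smul_sub, smul_comm])
    (by rw [dotProduct_sub, dotProduct_smul, smul_eq_mul, div_mul_cancel₀ _ hx0, sub_self])
  exact sub_eq_zero.1 this

lemma volume_setOf_dotProduct_eq_zero {x : Fin M → ℂ} (hx : x ≠ 0) :
    volume {h : Fin M → ℂ | h ⬝ᵥ x = 0} = 0 := by
  let f : (Fin M → ℂ) →ₗ[ℝ] ℂ :=
    { toFun := fun h => h ⬝ᵥ x
      map_add' := fun a b => add_dotProduct a b x
      map_smul' := fun r a => smul_dotProduct r a x }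
  have : {h : Fin M → ℂ | h ⬝ᵥ x = 0} = (LinearMap.ker f : Set (Fin M → ℂ)) := by
    ext h; simp [f]
  rw [this]
  refine Measure.addHaar_submodule _ _ fun htop => hx ?_
  have h1 : star x ∈ LinearMap.ker f := htop ▸ Submodule.mem_top
  rw [LinearMap.mem_ker] at h1
  exact dotProduct_star_self_eq_zero.1 h1

/-- There are finitely many eigenvalues and each relevant eigenspace is a line, so the bad rows lie
in a finite union of hyperplanes. -/
lemma volume_setOf_killsEigenvector {A : Matrix (Fin M) (Fin M) ℂ}
    (hA : SimpleNonzeroSpectrum A) : volume {h | KillsEigenvector A h} = 0 := by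
  have hfin : {β : ℂ | Module.End.HasEigenvalue (toLin' A) β}.Finite :=
    Module.End.finite_hasEigenvalue _
  have hsub : {h | KillsEigenvector A h} ⊆
      ⋃ β ∈ {β : ℂ | Module.End.HasEigenvalue (toLin' A) β},
        {h | β ≠ 0 ∧ ∃ x : Fin M → ℂ, x ≠ 0 ∧ A *ᵥ x = β • x ∧ h ⬝ᵥ x = 0} := by
    rintro h ⟨β, hβ, x, hx, hAx, hhx⟩
    refine Set.mem_biUnion (x := β) ?_ ⟨hβ, x, hx, hAx, hhx⟩
    exact Module.End.hasEigenvalue_of_hasEigenvector (x := x)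
      ⟨Module.End.mem_eigenspace_iff.2 (by simpa using hAx), hx⟩
  refine measure_mono_null hsub ((measure_biUnion_null_iff hfin.countable).2 fun β hβ => ?_)
  obtain ⟨y, hy, hy0⟩ := Module.End.HasEigenvalue.exists_hasEigenvector hβ
  have hyA : A *ᵥ y = β • y := by simpa using Module.End.mem_eigenspace_iff.1 hy
  refine measure_mono_null ?_ (volume_setOf_dotProduct_eq_zero hy0)
  rintro h ⟨hβ0, x, hx, hAx, hhx⟩
  obtain ⟨c, rfl⟩ := hA β hβ0 x y hx hAx hyA
  simp [hhx]

/-- Eigenvectors can be normalised and nonzero eigenvalues confined to annuli. Over each compact set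
`T n` of such pairs the condition is closed, and projecting out a compact factor keeps it closed;
the set is the countable union. -/
lemma measurableSet_killsEigenvector {E : Type*} [TopologicalSpace E] [SecondCountableTopology E]
    [MeasurableSpace E] [BorelSpace E] {A : E → Matrix (Fin M) (Fin M) ℂ} (hA : Continuous A) :
    MeasurableSet {q : E × (Fin M → ℂ) | KillsEigenvector (A q.1) q.2} := by
  let T : ℕ → Set (ℂ × (Fin M → ℂ)) := fun n =>
    {t | (1 / (n + 1 : ℝ) ≤ ‖t.1‖ ∧ ‖t.1‖ ≤ n + 1) ∧ ‖t.2‖ = 1}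
  have hT : ∀ n, IsCompact (T n) := by
    intro n
    refine Metric.isCompact_of_isClosed_isBounded ?_ ?_
    · have h1 : IsClosed {t : ℂ × (Fin M → ℂ) | 1 / (n + 1 : ℝ) ≤ ‖t.1‖} :=
        isClosed_le continuous_const (by fun_prop)
      have h2 : IsClosed {t : ℂ × (Fin M → ℂ) | ‖t.1‖ ≤ n + 1} :=
        isClosed_le (by fun_prop) continuous_const
      have h3 : IsClosed {t : ℂ × (Fin M → ℂ) | ‖t.2‖ = 1} :=
        isClosed_eq (by fun_prop) continuous_const
      exact (h1.inter h2).inter h3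
    · refine isBounded_iff_forall_norm_le.2 ⟨n + 1, ?_⟩
      rintro ⟨b, x⟩ ⟨⟨-, h2⟩, h3⟩
      refine max_le h2 (h3.le.trans ?_)
      have : (0 : ℝ) ≤ n := n.cast_nonneg
      linarith
  have hcl : ∀ n, IsClosed {q : E × (Fin M → ℂ) |
      ∃ t : T n, A q.1 *ᵥ t.1.2 = t.1.1 • t.1.2 ∧ q.2 ⬝ᵥ t.1.2 = 0} := by
    intro n
    have : CompactSpace (T n) := isCompact_iff_compactSpace.1 (hT n)
    have h1 : IsClosed {z : T n × (E × (Fin M → ℂ)) |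
        A z.2.1 *ᵥ z.1.1.2 = z.1.1.1 • z.1.1.2 ∧ z.2.2 ⬝ᵥ z.1.1.2 = 0} := by
      refine (isClosed_eq ?_ ?_).inter (isClosed_eq ?_ ?_)
      · exact (hA.comp (by fun_prop)).matrix_mulVec (by fun_prop)
      · fun_prop
      · exact Continuous.dotProduct (by fun_prop) (by fun_prop)
      · fun_prop
    convert isClosedMap_snd_of_compactSpace _ h1 using 1
    ext q
    simp
  have : {q : E × (Fin M → ℂ) | KillsEigenvector (A q.1) q.2} = ⋃ n, {q : E × (Fin M → ℂ) |
      ∃ t : T n, A q.1 *ᵥ t.1.2 = t.1.1 • t.1.2 ∧ q.2 ⬝ᵥ t.1.2 = 0} := by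
    ext q
    simp only [Set.mem_ofPred_eq, Set.mem_iUnion]
    constructor
    · rintro ⟨β, hβ, x, hx, hAx, hhx⟩
      obtain ⟨n₁, hn₁⟩ := exists_nat_one_div_lt (norm_pos_iff.2 hβ)
      obtain ⟨n₂, hn₂⟩ := exists_nat_ge ‖β‖
      have hx' : ‖x‖ ≠ 0 := norm_ne_zero_iff.2 hx
      refine ⟨max n₁ n₂, ⟨(β, ((‖x‖⁻¹ : ℝ) : ℂ) • x), ⟨⟨?_, ?_⟩, ?_⟩⟩, ?_, ?_⟩
      · refine le_trans ?_ hn₁.le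
        apply one_div_le_one_div_of_le (by positivity)
        simp
      · refine hn₂.trans (le_trans ?_ (le_add_of_nonneg_right zero_le_one))
        simp
      · simp [norm_smul, hx']
      · simp only [mulVec_smul, hAx]
        rw [smul_comm]
      · simp [hhx]
    · rintro ⟨n, ⟨⟨β, x⟩, ⟨⟨h1, h2⟩, h3⟩⟩, hAx, hhx⟩
      refine ⟨β, ?_, x, ?_, hAx, hhx⟩
      · rintro rfl
        have : (0 : ℝ) < 1 / (n + 1 : ℝ) := by positivity
        simp only [norm_zero] at h1
        linarith
      · rintro rfl
        simp at h3
  rw [this]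
  exact MeasurableSet.iUnion fun n => (hcl n).measurableSet

/-! ### Almost sure genericity -/

/-- By independence the joint law is a product, so Fubini reduces the claim to null sections. -/
lemma ae_notMem_of_indepFun {Ω E F : Type*} [MeasurableSpace Ω] [MeasurableSpace E]
    [MeasurableSpace F] {μ : Measure Ω} [IsProbabilityMeasure μ] {ν : Measure F}
    {X : Ω → E} {Y : Ω → F} (hX : Measurable X) (hY : Measurable Y) (hXY : IndepFun X Y μ)
    (hν : μ.map Y ≪ ν) {B : Set (E × F)} (hB : MeasurableSet B)
    (h0 : ∀ᵐ ω ∂μ, ν {y | (X ω, y) ∈ B} = 0) : ∀ᵐ ω ∂μ, (X ω, Y ω) ∉ B := by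
  have := Measure.isProbabilityMeasure_map (μ := μ) hX.aemeasurable
  have := Measure.isProbabilityMeasure_map (μ := μ) hY.aemeasurable
  have h1 : (μ.map fun ω => (X ω, Y ω)) B = 0 := by
    rw [(indepFun_iff_map_prod_eq_prod_map_map hX.aemeasurable hY.aemeasurable).1 hXY,
      Measure.measure_prod_null hB]
    refine (ae_map_iff hX.aemeasurable
      (measurable_measure_prodMk_left hB (measurableSet_singleton 0))).2 ?_
    filter_upwards [h0] with ω hω
    exact hν hω
  rw [Measure.map_apply (hX.prodMk hY) hB] at h1
  exact measure_eq_zero_iff_ae_notMem.1 h1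

section
variable {Ω ι : Type*} [MeasurableSpace Ω] {μ : Measure Ω} [IsProbabilityMeasure μ]
  {f : ι → Ω → Fin M → ℂ}

lemma ae_not_killsEigenvector_of_notMem (hf : ∀ i, Measurable (f i)) (hind : iIndepFun f μ)
    (hac : ∀ i, μ.map (f i) ≪ volume) (c : ι → ℂ) {s : Finset ι} {i : ι} (hi : i ∉ s)
    (hs : ∀ᵐ ω ∂μ, SimpleNonzeroSpectrum (∑ j ∈ s, c j • gram (f j ω))) :
    ∀ᵐ ω ∂μ, ¬ KillsEigenvector (∑ j ∈ s, c j • gram (f j ω)) (f i ω) := by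
  classical
  let A : (s → Fin M → ℂ) → Matrix (Fin M) (Fin M) ℂ := fun e => ∑ j : s, c j • gram (e j)
  have hA : Continuous A := by
    refine continuous_finsetSum _ fun j _ => ?_
    have hg : Continuous fun e : s → Fin M → ℂ => gram (e j) :=
      Continuous.matrix_vecMulVec (by fun_prop) (by fun_prop)
    exact hg.const_smul (c j)
  have hAe : ∀ ω, A (fun j : s => f j ω) = ∑ j ∈ s, c j • gram (f j ω) := fun ω =>
    Finset.sum_coe_sort s fun j => c j • gram (f j ω)
  have hXY : IndepFun (fun ω (j : s) => f j ω) (f i) μ := by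
    have := hind.indepFun_finset s {i} (Finset.disjoint_singleton_right.2 hi) hf
    exact this.comp (φ := id) (ψ := fun e : (({i} : Finset ι) → Fin M → ℂ) =>
      e ⟨i, Finset.mem_singleton_self i⟩) measurable_id (measurable_pi_apply _)
  have := ae_notMem_of_indepFun (measurable_pi_lambda _ fun j : s => hf j) (hf i) hXY (hac i)
    (measurableSet_killsEigenvector hA) (by
      filter_upwards [hs] with ω hω
      simp only [hAe]
      exact volume_setOf_killsEigenvector hω)
  filter_upwards [this] with ω hω
  simpa only [Set.mem_ofPred_eq, hAe] using hω

lemma ae_simpleNonzeroSpectrum (hf : ∀ i, Measurable (f i)) (hind : iIndepFun f μ)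
    (hac : ∀ i, μ.map (f i) ≪ volume) (c : ι → ℂ) (s : Finset ι) :
    ∀ᵐ ω ∂μ, SimpleNonzeroSpectrum (∑ j ∈ s, c j • gram (f j ω)) := by
  classical
  induction s using Finset.induction_on with
  | empty =>
    refine Filter.Eventually.of_forall fun ω β hβ x y hx hxA _ => ?_
    simp only [Finset.sum_empty, zero_mulVec] at hxA
    exact absurd (smul_eq_zero.1 hxA.symm) (by simp [hβ, hx])
  | insert i s hi ih =>
    filter_upwards [ae_not_killsEigenvector_of_notMem hf hind hac c hi ih] with ω hω
    rw [Finset.sum_insert hi, add_comm]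
    exact simpleNonzeroSpectrum_add_gram hω _

end

/-- Puts `G` in terms of the single independent family `Sum.elim h g`. The sum runs over the right
summand only, so the coefficients `0` on the left are dummies. -/
lemma energyMatrix_eq {KI KE : ℕ} (p : Params KI KE) (h : Fin KI → Fin M → ℂ)
    (g : Fin KE → Fin M → ℂ) : energyMatrix p g =
      ∑ k ∈ Finset.univ.map (Function.Embedding.inr (α := Fin KI) (β := Fin KE)),
        (Sum.elim (fun _ => 0) (fun j => (p.ζ : ℂ) * p.α j) k : ℂ) • gram (Sum.elim h g k) := by
  simp [energyMatrix, Finset.smul_sum, mul_smul]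

lemma ae_generic {KI KE : ℕ} (p : Params KI KE) (hM : 1 < M)
    {Ω : Type*} [MeasurableSpace Ω] {μ : Measure Ω} [IsProbabilityMeasure μ]
    {h : Fin KI → Ω → Fin M → ℂ} {g : Fin KE → Ω → Fin M → ℂ}
    (hchan : IndependentChannels μ h g) :
    ∀ᵐ ω ∂μ, SimpleNonzeroSpectrum (energyMatrix p fun j => g j ω) ∧
      (∀ i, ¬ KillsEigenvector (energyMatrix p fun j => g j ω) (h i ω)) ∧ ∀ j, g j ω ≠ 0 := by
  have hf : ∀ i, Measurable (Sum.elim h g i) :=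
    Sum.rec hchan.measurable_h hchan.measurable_g
  have hac : ∀ i, μ.map (Sum.elim h g i) ≪ volume :=
    Sum.rec (fun i => (hchan.density_h i).absolutelyContinuous')
      (fun j => (hchan.density_g j).absolutelyContinuous')
  have hel : ∀ ω k, Sum.elim (fun i => h i ω) (fun j => g j ω) k = Sum.elim h g k ω := by
    rintro ω (k | k) <;> rfl
  have h1 := ae_simpleNonzeroSpectrum hf hchan.indep hac
    (Sum.elim (fun _ => 0) (fun j => (p.ζ : ℂ) * p.α j))
    (Finset.univ.map (Function.Embedding.inr (α := Fin KI) (β := Fin KE)))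
  have h2 := fun i : Fin KI => ae_not_killsEigenvector_of_notMem hf hchan.indep hac
    (Sum.elim (fun _ => 0) (fun j => (p.ζ : ℂ) * p.α j)) (i := Sum.inl i) (by simp) h1
  have h3 : ∀ j, ∀ᵐ ω ∂μ, g j ω ≠ 0 := by
    intro j
    have : NeZero M := ⟨by omega⟩
    have : μ (g j ⁻¹' {0}) = 0 := by
      rw [← Measure.map_apply (hchan.measurable_g j) (measurableSet_singleton 0)]
      exact (hchan.density_g j).absolutelyContinuous' (measure_singleton _)
    exact measure_eq_zero_iff_ae_notMem.1 this
  filter_upwards [h1, ae_all_iff.2 h2, ae_all_iff.2 h3] with ω h1 h2 h3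
  rw [energyMatrix_eq p (fun i => h i ω)]
  simp only [hel]
  exact ⟨h1, h2, h3⟩

end SWIPT

namespace SWIPT

/-! ### Separation from the positive orthant -/

/-- Hahn–Banach separates `C` from the open positive orthant. As the orthant is a cone, the
separating level is nonnegative and the functional has nonpositive coefficients; their negatives are
the weights. -/
lemma exists_nonneg_weights_of_convex {κ : Type*} [Fintype κ] {C : Set (κ → ℝ)} (hC : Convex ℝ C)
    (hne : C.Nonempty) (hpos : ∀ y ∈ C, ∃ k, y k ≤ 0) :
    ∃ m : κ → ℝ, (∀ k, 0 ≤ m k) ∧ (∃ k, 0 < m k) ∧ ∀ y ∈ C, ∑ k, m k * y k ≤ 0 := by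
  classical
  let O : Set (κ → ℝ) := Set.univ.pi fun _ => Set.Ioi 0
  have hO : IsOpen O := isOpen_set_pi Set.finite_univ fun _ _ => isOpen_Ioi
  have hOc : Convex ℝ O := convex_pi fun _ _ => convex_Ioi 0
  have hdisj : Disjoint O C := by
    rw [Set.disjoint_left]
    intro y hy hyC
    obtain ⟨k, hk⟩ := hpos y hyC
    exact absurd (hy k (Set.mem_univ k)) (not_lt.2 hk)
  obtain ⟨f, u, hfO, hfC⟩ := geometric_hahn_banach_open hOc hO hC hdisj
  have hf : ∀ y : κ → ℝ, f y = ∑ k, f (Pi.single k 1) * y k := by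
    intro y
    conv_lhs => rw [← Finset.univ_sum_single y]
    rw [map_sum]
    refine Finset.sum_congr rfl fun k _ => ?_
    have : (Pi.single k (y k) : κ → ℝ) = y k • Pi.single k (1 : ℝ) := by
      rw [← Pi.single_smul, smul_eq_mul, mul_one]
    rw [this, map_smul, smul_eq_mul, mul_comm]
  have h1 : ∀ t : ℝ, 0 < t → t * f 1 < u := by
    intro t ht
    rw [← smul_eq_mul, ← map_smul]
    exact hfO _ fun k _ => by simpa using ht
  have hu : 0 ≤ u := by
    by_contra hu
    push Not at hu
    have h2 := h1 1 one_pos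
    rw [one_mul] at h2
    -- This scaling makes the functional equal `u / 2`, which exceeds a negative `u`.
    have h3 := h1 (u / (2 * f 1)) (div_pos_of_neg_of_neg hu (by linarith))
    have h4 : u / (2 * f 1) * f 1 = u / 2 := by
      have : f 1 ≠ 0 := by linarith
      field_simp
    linarith
  have hm : ∀ k, f (Pi.single k 1) ≤ 0 := by
    intro k
    by_contra hk
    push Not at hk
    have h2 : ∀ t : ℝ, 0 ≤ t → t * f (Pi.single k 1) + f 1 < u := by
      intro t ht
      rw [← smul_eq_mul, ← map_smul, ← map_add]
      refine hfO _ fun l _ => ?_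
      have : (0 : ℝ) ≤ (Pi.single k (1 : ℝ) : κ → ℝ) l := by
        by_cases hl : l = k
        · subst hl; simp
        · simp [hl]
      simp only [Set.mem_Ioi, Pi.add_apply, Pi.smul_apply, smul_eq_mul, Pi.one_apply]
      positivity
    have h3 := h2 ((u + |f 1|) / f (Pi.single k 1)) (by positivity)
    rw [div_mul_cancel₀ _ hk.ne'] at h3
    linarith [neg_abs_le (f 1)]
  refine ⟨fun k => -f (Pi.single k 1), fun k => neg_nonneg.2 (hm k), ?_, ?_⟩
  · by_contra! h0
    have hf0 : ∀ y, f y = 0 := by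
      intro y
      rw [hf]
      refine Finset.sum_eq_zero fun k _ => ?_
      rw [le_antisymm (hm k) (by linarith [h0 k]), zero_mul]
    obtain ⟨b, hb⟩ := hne
    have h2 := h1 1 one_pos
    have h3 := hfC b hb
    rw [hf0] at h2 h3
    linarith
  · intro y hy
    have h2 := hfC y hy
    rw [hf] at h2
    simp only [neg_mul, Finset.sum_neg_distrib]
    linarith

/-! ### Traces and positive semidefinite matrices -/

variable {M KI KE : ℕ}

lemma trace_mul_outer (A : Matrix (Fin M) (Fin M) ℂ) (x : Fin M → ℂ) :
    (A * outer x).trace = star x ⬝ᵥ A *ᵥ x := by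
  rw [outer, mul_vecMulVec, trace_vecMulVec, dotProduct_comm]

lemma trace_gram_mul_outer_re (h w : Fin M → ℂ) :
    (gram h * outer w).trace.re = ‖h ⬝ᵥ w‖ ^ 2 := by
  rw [trace_mul_outer, gram_mulVec, dotProduct_smul, star_dotProduct_star, smul_eq_mul,
    ← Complex.ofReal_re (‖h ⬝ᵥ w‖ ^ 2), ← Complex.normSq_eq_norm_sq, ← Complex.mul_conj]
  rfl

lemma trace_outer_re (w : Fin M → ℂ) : (outer w).trace.re = sqNorm w := by
  simp only [outer, trace_vecMulVec, dotProduct, sqNorm, Complex.re_sum]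
  refine Finset.sum_congr rfl fun m _ => ?_
  rw [← Complex.normSq_eq_norm_sq, ← Complex.ofReal_re (Complex.normSq _), ← Complex.mul_conj]
  rfl

lemma isHermitian_gram (h : Fin M → ℂ) : (gram h).IsHermitian :=
  (posSemidef_vecMulVec_star_self h).isHermitian

lemma posSemidef_gram (h : Fin M → ℂ) : (gram h).PosSemidef := posSemidef_vecMulVec_star_self h

lemma posSemidef_outer (w : Fin M → ℂ) : (outer w).PosSemidef := posSemidef_vecMulVec_self_star w

section
open scoped MatrixOrder

lemma exists_eq_conjTranspose_mul_self {W : Matrix (Fin M) (Fin M) ℂ} (hW : W.PosSemidef) :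
    ∃ B : Matrix (Fin M) (Fin M) ℂ, W = Bᴴ * B :=
  CStarAlgebra.nonneg_iff_eq_star_mul_self.mp hW.nonneg

end

lemma trace_mul_re_nonneg {A W : Matrix (Fin M) (Fin M) ℂ} (hA : A.PosSemidef)
    (hW : W.PosSemidef) : 0 ≤ (A * W).trace.re := by
  obtain ⟨B, rfl⟩ := exists_eq_conjTranspose_mul_self hW
  rw [← mul_assoc, trace_mul_comm, ← mul_assoc]
  exact (Complex.le_def.1 (hA.mul_mul_conjTranspose_same B).trace_nonneg).1

/-- With `A = CᴴC` and `W = BᴴB`, the trace is the squared Frobenius norm of `C Bᴴ`. -/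
lemma mul_eq_zero_of_trace_re_eq_zero {A W : Matrix (Fin M) (Fin M) ℂ} (hA : A.PosSemidef)
    (hW : W.PosSemidef) (h : (A * W).trace.re = 0) : A * W = 0 := by
  obtain ⟨B, rfl⟩ := exists_eq_conjTranspose_mul_self hW
  obtain ⟨C, rfl⟩ := exists_eq_conjTranspose_mul_self hA
  have hps : (B * (Cᴴ * C) * Bᴴ).PosSemidef := hA.mul_mul_conjTranspose_same B
  rw [← mul_assoc, trace_mul_comm, ← mul_assoc] at h
  have h0 : (B * (Cᴴ * C) * Bᴴ).trace = 0 :=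
    Complex.ext h (Complex.le_def.1 hps.trace_nonneg).2.symm
  have h1 : (C * Bᴴ)ᴴ * (C * Bᴴ) = 0 := by
    rw [← hps.trace_eq_zero_iff.1 h0, conjTranspose_mul, conjTranspose_conjTranspose]
    simp only [mul_assoc]
  have h2 : C * Bᴴ = 0 := conjTranspose_mul_self_eq_zero.1 h1
  rw [← mul_assoc, mul_assoc Cᴴ, h2, mul_zero, zero_mul]

lemma posSemidef_of_re_nonneg {A : Matrix (Fin M) (Fin M) ℂ} (hA : A.IsHermitian)
    (h : ∀ x, 0 ≤ (star x ⬝ᵥ A *ᵥ x).re) : A.PosSemidef :=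
  .of_dotProduct_mulVec_nonneg hA fun x =>
    Complex.le_def.2 ⟨h x, (hA.im_star_dotProduct_mulVec_self x).symm⟩

/-- Vanishing 2×2 minors give `W k l * W m m = W k m * W m l`; so column `m`, divided by `√(W m m)`
for a nonzero diagonal entry, is the required beam. -/
lemma exists_eq_outer_of_vecMulVec {W : Matrix (Fin M) (Fin M) ℂ} (hW : W.PosSemidef)
    (a b : Fin M → ℂ) (hab : W = vecMulVec a b) : ∃ w, W = outer w := by
  by_cases h0 : W = 0
  · exact ⟨0, by simp [h0, outer]⟩
  obtain ⟨m, hm⟩ : ∃ m, W m m ≠ 0 := by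
    by_contra! hd
    exact h0 (hW.trace_eq_zero_iff.1 (Finset.sum_eq_zero fun m _ => hd m))
  obtain ⟨hre, him⟩ := Complex.le_def.1 (hW.diag_nonneg (i := m))
  have hmm : W m m = ((W m m).re : ℂ) := Complex.ext rfl him.symm
  set r := (W m m).re
  have hr : 0 < r := lt_of_le_of_ne hre fun h => hm (by rw [hmm, ← h]; simp)
  have hs : ((Real.sqrt r : ℝ) : ℂ) * (Real.sqrt r : ℝ) = r := by
    rw [← Complex.ofReal_mul, Real.mul_self_sqrt hr.le]
  have hr' : (r : ℂ) ≠ 0 := by exact_mod_cast hr.ne'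
  refine ⟨fun k => W k m / (Real.sqrt r : ℝ), ?_⟩
  ext k l
  have h1 : star (W l m) = W m l := hW.isHermitian.apply m l
  have h2 : W k l * W m m = W k m * W m l := by
    rw [hab]; simp only [vecMulVec_apply]; ring
  simp only [outer, vecMulVec_apply, Pi.star_apply, star_div₀, h1]
  rw [hmm] at h2
  have : star ((Real.sqrt r : ℝ) : ℂ) = (Real.sqrt r : ℝ) := Complex.conj_ofReal _
  rw [this, div_mul_div_comm, hs, eq_div_iff hr', h2]

/-! ### Multipliers at an optimal point of the relaxation -/

/-- The dual slack matrix `β I + ∑ₖ λₖ hₖᴴ hₖ - c G` of the energy covariance. -/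
noncomputable def dualE (p : Params KI KE) (h : Fin KI → Fin M → ℂ) (g : Fin KE → Fin M → ℂ)
    (c β : ℝ) (l : Fin KI → ℝ) : Matrix (Fin M) (Fin M) ℂ :=
  (β : ℂ) • 1 + ∑ k, (l k : ℂ) • gram (h k) - (c : ℂ) • energyMatrix p g

/-- The dual slack matrix of the `i`-th information covariance. -/
noncomputable def dualI (p : Params KI KE) (h : Fin KI → Fin M → ℂ) (g : Fin KE → Fin M → ℂ)
    (c β : ℝ) (l : Fin KI → ℝ) (i : Fin KI) : Matrix (Fin M) (Fin M) ℂ :=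
  dualE p h g c β l - ((l i * (1 / p.γ i + 1) : ℝ) : ℂ) • gram (h i)

lemma isHermitian_ofReal_smul {A : Matrix (Fin M) (Fin M) ℂ} (hA : A.IsHermitian) (r : ℝ) :
    ((r : ℂ) • A).IsHermitian := by
  rw [IsHermitian, conjTranspose_smul, hA.eq]
  congr 1
  exact Complex.conj_ofReal r

lemma isHermitian_sum {ι : Type*} (s : Finset ι) {A : ι → Matrix (Fin M) (Fin M) ℂ}
    (hA : ∀ i, (A i).IsHermitian) : (∑ i ∈ s, A i).IsHermitian := by
  rw [IsHermitian, conjTranspose_sum]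
  exact Finset.sum_congr rfl fun i _ => (hA i).eq

lemma isHermitian_energyMatrix (p : Params KI KE) (g : Fin KE → Fin M → ℂ) :
    (energyMatrix p g).IsHermitian :=
  isHermitian_ofReal_smul
    (isHermitian_sum _ fun j => isHermitian_ofReal_smul (isHermitian_gram (g j)) _) _

lemma isHermitian_dualE (p : Params KI KE) (h : Fin KI → Fin M → ℂ) (g : Fin KE → Fin M → ℂ)
    (c β : ℝ) (l : Fin KI → ℝ) : (dualE p h g c β l).IsHermitian :=
  ((isHermitian_ofReal_smul isHermitian_one _).add
    (isHermitian_sum _ fun k => isHermitian_ofReal_smul (isHermitian_gram (h k)) _)).sub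
    (isHermitian_ofReal_smul (isHermitian_energyMatrix p g) _)

lemma isHermitian_dualI (p : Params KI KE) (h : Fin KI → Fin M → ℂ) (g : Fin KE → Fin M → ℂ)
    (c β : ℝ) (l : Fin KI → ℝ) (i : Fin KI) : (dualI p h g c β l i).IsHermitian :=
  (isHermitian_dualE p h g c β l).sub (isHermitian_ofReal_smul (isHermitian_gram (h i)) _)

lemma trace_ofReal_smul_mul_re (r : ℝ) (A W : Matrix (Fin M) (Fin M) ℂ) :
    (((r : ℂ) • A) * W).trace.re = r * (A * W).trace.re := by
  rw [smul_mul, trace_smul, smul_eq_mul, Complex.re_ofReal_mul]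

lemma trace_dualE_mul_re (p : Params KI KE) (h : Fin KI → Fin M → ℂ) (g : Fin KE → Fin M → ℂ)
    (c β : ℝ) (l : Fin KI → ℝ) (W : Matrix (Fin M) (Fin M) ℂ) :
    (dualE p h g c β l * W).trace.re = β * W.trace.re +
      ∑ k, l k * (gram (h k) * W).trace.re - c * (energyMatrix p g * W).trace.re := by
  simp only [dualE, sub_mul, add_mul, trace_sub, trace_add, Complex.sub_re, Complex.add_re,
    Finset.sum_mul, trace_sum, Complex.re_sum, trace_ofReal_smul_mul_re, one_mul]

lemma trace_dualI_mul_re (p : Params KI KE) (h : Fin KI → Fin M → ℂ) (g : Fin KE → Fin M → ℂ)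
    (c β : ℝ) (l : Fin KI → ℝ) (i : Fin KI) (W : Matrix (Fin M) (Fin M) ℂ) :
    (dualI p h g c β l i * W).trace.re = (dualE p h g c β l * W).trace.re -
      l i * (1 / p.γ i + 1) * (gram (h i) * W).trace.re := by
  simp only [dualI, sub_mul, trace_sub, Complex.sub_re, trace_ofReal_smul_mul_re]

/-- The value of the `i`-th constraint of the relaxation. -/
noncomputable def sinrSlack (p : Params KI KE) (h : Fin KI → Fin M → ℂ)
    (X : (Fin KI → Matrix (Fin M) (Fin M) ℂ) × Matrix (Fin M) (Fin M) ℂ) (i : Fin KI) : ℝ :=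
  (gram (h i) * X.1 i).trace.re / p.γ i
    - ∑ k ∈ Finset.univ.erase i, (gram (h i) * X.1 k).trace.re
    - (gram (h i) * X.2).trace.re - p.σ i ^ 2

/-- The total transmit power. -/
noncomputable def power
    (X : (Fin KI → Matrix (Fin M) (Fin M) ℂ) × Matrix (Fin M) (Fin M) ℂ) : ℝ :=
  ∑ i, (X.1 i).trace.re + X.2.trace.re

/-- Completing each interference sum with its missing term `k = i` produces the `+ 1` in `1 / γ i +
1` and lets all receivers share the matrix `dualE`. -/
lemma lagrangian_eq (p : Params KI KE) (h : Fin KI → Fin M → ℂ) (g : Fin KE → Fin M → ℂ)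
    (c β : ℝ) (l : Fin KI → ℝ)
    (X : (Fin KI → Matrix (Fin M) (Fin M) ℂ) × Matrix (Fin M) (Fin M) ℂ) :
    ∑ i, (dualI p h g c β l i * X.1 i).trace.re + (dualE p h g c β l * X.2).trace.re =
      β * power X - c * sdr1Objective p g X - ∑ i, l i * (sinrSlack p h X i + p.σ i ^ 2) := by
  have h1 : ∀ i, l i * (sinrSlack p h X i + p.σ i ^ 2) =
      l i * (1 / p.γ i + 1) * (gram (h i) * X.1 i).trace.re
        - ∑ k, l i * (gram (h i) * X.1 k).trace.re - l i * (gram (h i) * X.2).trace.re := by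
    intro i
    rw [sinrSlack, Finset.sum_erase_eq_sub (Finset.mem_univ i), ← Finset.mul_sum]
    ring
  simp only [h1, trace_dualI_mul_re, trace_dualE_mul_re, power, sdr1Objective,
    Finset.sum_sub_distrib, Finset.sum_add_distrib, Finset.mul_sum, mul_add]
  rw [Finset.sum_comm (f := fun i k => l i * (gram (h i) * X.1 k).trace.re)]
  ring

lemma trace_mul_comb_re (A U V : Matrix (Fin M) (Fin M) ℂ) (a b : ℝ) :
    (A * (a • U + b • V)).trace.re = a * (A * U).trace.re + b * (A * V).trace.re := by
  simp [mul_add, trace_add, trace_smul]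

lemma trace_comb_re (U V : Matrix (Fin M) (Fin M) ℂ) (a b : ℝ) :
    (a • U + b • V).trace.re = a * U.trace.re + b * V.trace.re := by
  simp [trace_add, trace_smul]

lemma posSemidef_comb {U V : Matrix (Fin M) (Fin M) ℂ} (hU : U.PosSemidef) (hV : V.PosSemidef)
    {a b : ℝ} (ha : 0 ≤ a) (hb : 0 ≤ b) : (a • U + b • V).PosSemidef :=
  (hU.smul ha).add (hV.smul hb)

/-- First-order conditions in Fritz John form; no constraint qualification is needed. -/
lemma exists_multipliers {p : Params KI KE} {h : Fin KI → Fin M → ℂ} {g : Fin KE → Fin M → ℂ}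
    {X : (Fin KI → Matrix (Fin M) (Fin M) ℂ) × Matrix (Fin M) (Fin M) ℂ}
    (hX : IsSDR1Optimal p h g X) :
    ∃ (c β : ℝ) (l : Fin KI → ℝ), 0 ≤ c ∧ 0 ≤ β ∧ (∀ i, 0 ≤ l i) ∧
      (0 < c ∨ 0 < β ∨ ∃ i, 0 < l i) ∧
      c * sdr1Objective p g X + ∑ i, l i * p.σ i ^ 2 = β * p.P ∧
      (dualE p h g c β l).PosSemidef ∧ (∀ i, (dualI p h g c β l i).PosSemidef) ∧
      dualE p h g c β l * X.2 = 0 ∧ ∀ i, dualI p h g c β l i * X.1 i = 0 := by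
  obtain ⟨⟨hXs, hXp, hX1, hX2⟩, hmax⟩ := hX
  let K : Set ((Fin KI → Matrix (Fin M) (Fin M) ℂ) × Matrix (Fin M) (Fin M) ℂ) :=
    {Y | (∀ i, (Y.1 i).PosSemidef) ∧ Y.2.PosSemidef}
  -- Coordinates: `none` is the objective gain over `X`, `some none` the power slack, `some (some
  -- i)` the SINR slacks. A point of the cone `K` with all coordinates positive would be feasible
  -- and beat `X`.
  let F : (Fin KI → Matrix (Fin M) (Fin M) ℂ) × Matrix (Fin M) (Fin M) ℂ →
      Option (Option (Fin KI)) → ℝ := fun Y k =>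
    k.elim (sdr1Objective p g Y - sdr1Objective p g X)
      fun k => k.elim (p.P - power Y) fun i => sinrSlack p h Y i
  have hconv : Convex ℝ (F '' K) := by
    rintro _ ⟨U, hU, rfl⟩ _ ⟨V, hV, rfl⟩ a b ha hb hab
    refine ⟨a • U + b • V, ⟨fun i => posSemidef_comb (hU.1 i) (hV.1 i) ha hb,
      posSemidef_comb hU.2 hV.2 ha hb⟩, ?_⟩
    funext k
    rcases k with _ | _ | i
    · simp only [F, Option.elim, sdr1Objective, Prod.fst_add, Prod.snd_add, Prod.smul_fst,
        Prod.smul_snd, Pi.add_apply, Pi.smul_apply, trace_mul_comb_re, Finset.sum_add_distrib,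
        ← Finset.mul_sum, smul_eq_mul]
      linear_combination (∑ i, (energyMatrix p g * X.1 i).trace.re +
        (energyMatrix p g * X.2).trace.re) * hab
    · simp only [F, Option.elim, power, Prod.fst_add, Prod.snd_add, Prod.smul_fst,
        Prod.smul_snd, Pi.add_apply, Pi.smul_apply, trace_comb_re, Finset.sum_add_distrib,
        ← Finset.mul_sum, smul_eq_mul]
      linear_combination (-p.P) * hab
    · simp only [F, Option.elim, sinrSlack, Prod.fst_add, Prod.snd_add, Prod.smul_fst,
        Prod.smul_snd, Pi.add_apply, Pi.smul_apply, trace_mul_comb_re, Finset.sum_add_distrib,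
        ← Finset.mul_sum, smul_eq_mul]
      linear_combination (p.σ i ^ 2) * hab
  have hXK : X ∈ K := ⟨hX1, hX2⟩
  obtain ⟨m, hm0, hmpos, hm⟩ := exists_nonneg_weights_of_convex hconv ⟨_, X, hXK, rfl⟩ (by
    rintro _ ⟨Y, hY, rfl⟩
    by_contra! hall
    have h0 := hall none
    have h1 := hall (some none)
    have h2 := fun i => hall (some (some i))
    simp only [F, Option.elim] at h0 h1 h2
    have hYf : Y ∈ sdr1Feasible p h :=
      ⟨fun i => (h2 i).le, by simp only [power] at h1; linarith, hY.1, hY.2⟩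
    have h3 : sdr1Objective p g Y ≤ sdr1Objective p g X := hmax hYf
    linarith)
  obtain ⟨c, hc⟩ : ∃ c, c = m none := ⟨_, rfl⟩
  obtain ⟨β, hβ⟩ : ∃ β, β = m (some none) := ⟨_, rfl⟩
  obtain ⟨l, hl⟩ : ∃ l : Fin KI → ℝ, l = fun i => m (some (some i)) := ⟨_, rfl⟩
  have hc0 : 0 ≤ c := hc ▸ hm0 _
  have hβ0 : 0 ≤ β := hβ ▸ hm0 _
  have hl0 : ∀ i, 0 ≤ l i := fun i => hl ▸ hm0 _
  let Λ : (Fin KI → Matrix (Fin M) (Fin M) ℂ) × Matrix (Fin M) (Fin M) ℂ → ℝ := fun Y =>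
    ∑ i, (dualI p h g c β l i * Y.1 i).trace.re + (dualE p h g c β l * Y.2).trace.re
  have hsum : ∀ Y, ∑ i, l i * (sinrSlack p h Y i + p.σ i ^ 2) =
      ∑ i, l i * sinrSlack p h Y i + ∑ i, l i * p.σ i ^ 2 := fun Y => by
    simp only [mul_add, Finset.sum_add_distrib]
  have hΛ : ∀ Y ∈ K, β * p.P - c * sdr1Objective p g X - ∑ i, l i * p.σ i ^ 2 ≤ Λ Y := by
    intro Y hY
    have h1 := hm _ ⟨Y, hY, rfl⟩
    simp only [Fintype.sum_option, F, Option.elim, ← hc, ← hβ] at h1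
    have h2 : ∑ i, m (some (some i)) * sinrSlack p h Y i = ∑ i, l i * sinrSlack p h Y i := by
      rw [hl]
    simp only [Λ, lagrangian_eq, hsum]
    rw [h2] at h1
    linarith
  have hΛX : Λ X ≤ β * p.P - c * sdr1Objective p g X - ∑ i, l i * p.σ i ^ 2 := by
    have h1 : 0 ≤ ∑ i, l i * sinrSlack p h X i :=
      Finset.sum_nonneg fun i _ => mul_nonneg (hl0 i) (hXs i)
    have h2 : β * power X ≤ β * p.P := mul_le_mul_of_nonneg_left hXp hβ0
    simp only [Λ, lagrangian_eq, hsum]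
    linarith
  -- The constant `κ` on the left bounds the linear form `Λ` below on the cone `K`. Testing at `0`
  -- gives `κ ≤ 0`; testing at `X + X` gives `κ ≤ 2 Λ X ≤ 2 κ`. So `κ = 0`, whence `Λ ≥ 0` on `K`
  -- and `Λ X = 0`.
  have hκ1 : β * p.P - c * sdr1Objective p g X - ∑ i, l i * p.σ i ^ 2 ≤ 0 := by
    have := hΛ 0 ⟨fun i => PosSemidef.zero, PosSemidef.zero⟩
    simpa [Λ] using this
  have hκ2 : 0 ≤ β * p.P - c * sdr1Objective p g X - ∑ i, l i * p.σ i ^ 2 := by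
    have h1 := hΛ (X + X) ⟨fun i => (hX1 i).add (hX1 i), hX2.add hX2⟩
    have h2 : Λ (X + X) = Λ X + Λ X := by
      simp only [Λ, Prod.fst_add, Prod.snd_add, Pi.add_apply, mul_add, trace_add, Complex.add_re,
        Finset.sum_add_distrib]
      ring
    linarith
  have hκ := le_antisymm hκ1 hκ2
  rw [hκ] at hΛ hΛX
  have hE : (dualE p h g c β l).PosSemidef := by
    refine posSemidef_of_re_nonneg (isHermitian_dualE _ _ _ _ _ _) fun x => ?_
    have := hΛ (0, outer x) ⟨fun i => PosSemidef.zero, posSemidef_outer x⟩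
    rw [← trace_mul_outer]
    simpa [Λ] using this
  have hI : ∀ i, (dualI p h g c β l i).PosSemidef := by
    intro i
    refine posSemidef_of_re_nonneg (isHermitian_dualI _ _ _ _ _ _ _) fun x => ?_
    have := hΛ (Pi.single i (outer x), 0) ⟨fun k => ?_, PosSemidef.zero⟩
    · rw [← trace_mul_outer]
      simp only [Λ, mul_zero, trace_zero, Complex.zero_re, add_zero] at this
      rwa [Finset.sum_eq_single i (fun k _ hk => by simp [hk]) (by simp), Pi.single_eq_same] at this
    · by_cases hk : k = i
      · subst hk; simpa using posSemidef_outer x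
      · simpa [hk] using PosSemidef.zero
  have hE0 : 0 ≤ (dualE p h g c β l * X.2).trace.re := trace_mul_re_nonneg hE hX2
  have hI0 : ∀ i, 0 ≤ (dualI p h g c β l i * X.1 i).trace.re :=
    fun i => trace_mul_re_nonneg (hI i) (hX1 i)
  have hIs : 0 ≤ ∑ i, (dualI p h g c β l i * X.1 i).trace.re :=
    Finset.sum_nonneg fun i _ => hI0 i
  refine ⟨c, β, l, hc0, hβ0, hl0, ?_, by linarith, hE, hI, ?_, fun i => ?_⟩
  · obtain ⟨k, hk⟩ := hmpos
    rcases k with _ | _ | i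
    · exact Or.inl (hc ▸ hk)
    · exact Or.inr (Or.inl (hβ ▸ hk))
    · exact Or.inr (Or.inr ⟨i, hl ▸ hk⟩)
  · exact mul_eq_zero_of_trace_re_eq_zero hE hX2 (by simp only [Λ] at hΛX; linarith)
  · refine mul_eq_zero_of_trace_re_eq_zero (hI i) (hX1 i) ?_
    have h1 : ∑ i, (dualI p h g c β l i * X.1 i).trace.re = 0 := by
      simp only [Λ] at hΛX; linarith
    exact (Finset.sum_eq_zero_iff_of_nonneg fun i _ => hI0 i).1 h1 i (Finset.mem_univ i)

/-! ### Structure of the optimal points -/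

lemma star_dotProduct_self_eq_sqNorm (x : Fin M → ℂ) : star x ⬝ᵥ x = (sqNorm x : ℂ) := by
  simp only [dotProduct, sqNorm, Complex.ofReal_sum, Pi.star_apply]
  refine Finset.sum_congr rfl fun m _ => ?_
  rw [← Complex.normSq_eq_norm_sq, ← Complex.mul_conj, mul_comm]
  rfl

lemma sqNorm_pos {x : Fin M → ℂ} (hx : x ≠ 0) : 0 < sqNorm x := by
  obtain ⟨m, hm⟩ := Function.ne_iff.1 hx
  exact Finset.sum_pos' (fun m _ => by positivity)
    ⟨m, Finset.mem_univ m, pow_pos (norm_pos_iff.2 hm) 2⟩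

lemma trace_outer_of_sqNorm_eq_one {v : Fin M → ℂ} (hv : sqNorm v = 1) : (outer v).trace = 1 := by
  rw [outer, trace_vecMulVec, dotProduct_comm, star_dotProduct_self_eq_sqNorm, hv,
    Complex.ofReal_one]

/-- The columns give `Z = v sᵀ`; Hermitian symmetry contracted with `v` makes `s` proportional to
`star v`, and the trace identifies the factor. -/
lemma eq_trace_smul_outer {Z : Matrix (Fin M) (Fin M) ℂ} (hZ : Z.IsHermitian) {v : Fin M → ℂ}
    (hv : sqNorm v = 1) (hcol : ∀ m, ∃ s : ℂ, Z.col m = s • v) : Z = Z.trace • outer v := by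
  choose s hs using hcol
  have hZs : ∀ k m, Z k m = s m * v k := fun k m => by
    simpa using congrFun (hs m) k
  have hvv : ∑ m, v m * star (v m) = 1 := by
    have := trace_outer_of_sqNorm_eq_one hv
    rwa [outer, trace_vecMulVec] at this
  have hsk : ∀ k, s k = (∑ m, star (s m * v m)) * star (v k) := by
    intro k
    calc s k = s k * ∑ m, v m * star (v m) := by rw [hvv, mul_one]
      _ = ∑ m, star (s m * v m) * star (v k) := by
        rw [Finset.mul_sum]
        refine Finset.sum_congr rfl fun m _ => ?_
        have h1 : star (Z k m) = Z m k := hZ.apply m k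
        rw [hZs, hZs] at h1
        rw [← mul_assoc, ← h1, star_mul', star_mul']
        ring
      _ = _ := by rw [Finset.sum_mul]
  have hZo : Z = (∑ m, star (s m * v m)) • outer v := by
    ext k m
    rw [hZs, hsk m, Matrix.smul_apply, outer, vecMulVec_apply, smul_eq_mul, Pi.star_apply]
    ring
  have htr : Z.trace = ∑ m, star (s m * v m) := by
    conv_lhs => rw [hZo]
    rw [trace_smul, trace_outer_of_sqNorm_eq_one hv, smul_eq_mul, mul_one]
  rw [htr]
  exact hZo

lemma star_dotProduct_gram_mulVec (h x : Fin M → ℂ) :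
    star x ⬝ᵥ gram h *ᵥ x = ((‖h ⬝ᵥ x‖ ^ 2 : ℝ) : ℂ) := by
  rw [gram_mulVec, dotProduct_smul, star_dotProduct_star, smul_eq_mul,
    ← Complex.normSq_eq_norm_sq, ← Complex.mul_conj]
  rfl

lemma posSemidef_energyMatrix {p : Params KI KE} (hζ : 0 ≤ p.ζ) (hα : ∀ j, 0 ≤ p.α j)
    (g : Fin KE → Fin M → ℂ) : (energyMatrix p g).PosSemidef := by
  refine PosSemidef.smul (posSemidef_sum _ fun j _ => PosSemidef.smul (posSemidef_gram (g j)) ?_) ?_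
  · exact_mod_cast hα j
  · exact_mod_cast hζ

lemma energyMatrix_quadraticForm_pos {p : Params KI KE} (hζ : 0 < p.ζ) (hα : ∀ j, 0 ≤ p.α j)
    (hα' : ∃ j, 0 < p.α j) {g : Fin KE → Fin M → ℂ} (hg : ∀ j, g j ≠ 0) :
    ∃ x, 0 < (star x ⬝ᵥ energyMatrix p g *ᵥ x).re := by
  obtain ⟨j, hj⟩ := hα'
  refine ⟨star (g j), ?_⟩
  have h1 : ∀ x : Fin M → ℂ, (star x ⬝ᵥ energyMatrix p g *ᵥ x).re =
      p.ζ * ∑ j, p.α j * ‖g j ⬝ᵥ x‖ ^ 2 := by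
    intro x
    simp only [energyMatrix, smul_mulVec, sum_mulVec, dotProduct_smul, dotProduct_sum,
      star_dotProduct_gram_mulVec, smul_eq_mul]
    norm_cast
  rw [h1]
  refine mul_pos hζ (Finset.sum_pos' (fun k _ => mul_nonneg (hα k) (by positivity))
    ⟨j, Finset.mem_univ j, mul_pos hj (pow_pos (norm_pos_iff.2 ?_) 2)⟩)
  rw [Ne, dotProduct_self_star_eq_zero]
  exact hg j

lemma sdr1Objective_nonneg {p : Params KI KE} (hζ : 0 ≤ p.ζ) (hα : ∀ j, 0 ≤ p.α j)
    {h : Fin KI → Fin M → ℂ} (g : Fin KE → Fin M → ℂ)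
    {X : (Fin KI → Matrix (Fin M) (Fin M) ℂ) × Matrix (Fin M) (Fin M) ℂ}
    (hX : X ∈ sdr1Feasible p h) : 0 ≤ sdr1Objective p g X :=
  add_nonneg
    (Finset.sum_nonneg fun i _ =>
      trace_mul_re_nonneg (posSemidef_energyMatrix hζ hα g) (hX.2.2.1 i))
    (trace_mul_re_nonneg (posSemidef_energyMatrix hζ hα g) hX.2.2.2)

lemma sdr1Feasible_ne_zero {p : Params KI KE} (hσ : ∀ i, 0 < p.σ i) {h : Fin KI → Fin M → ℂ}
    {X : (Fin KI → Matrix (Fin M) (Fin M) ℂ) × Matrix (Fin M) (Fin M) ℂ}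
    (hX : X ∈ sdr1Feasible p h) (i : Fin KI) : X.1 i ≠ 0 := by
  intro h0
  have h1 := hX.1 i
  rw [h0] at h1
  have h2 : 0 ≤ ∑ k ∈ Finset.univ.erase i, (gram (h i) * X.1 k).trace.re :=
    Finset.sum_nonneg fun k _ => trace_mul_re_nonneg (posSemidef_gram _) (hX.2.2.1 k)
  have h3 := trace_mul_re_nonneg (posSemidef_gram (h i)) hX.2.2.2
  have h4 := pow_pos (hσ i) 2
  simp only [mul_zero, trace_zero, Complex.zero_re, zero_div] at h1
  linarith

lemma dualE_mulVec (p : Params KI KE) (h : Fin KI → Fin M → ℂ) (g : Fin KE → Fin M → ℂ)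
    (c β : ℝ) (l : Fin KI → ℝ) (x : Fin M → ℂ) : dualE p h g c β l *ᵥ x =
      (β : ℂ) • x + ∑ k, ((l k : ℂ) * (h k ⬝ᵥ x)) • star (h k)
        - (c : ℂ) • (energyMatrix p g *ᵥ x) := by
  simp only [dualE, sub_mulVec, add_mulVec, smul_mulVec, one_mulVec, sum_mulVec, gram_mulVec,
    smul_smul]

/-- On a kernel vector `x` the form of `dualI` is `-l i (1/γ i + 1) |hᵢ x|²`, so nonnegativity kills
every active `hᵢ x`. What is left is `β x = c G x`, which genericity rules out for `x ≠ 0`. -/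
lemma dualE_mulVec_injective {p : Params KI KE} (hγ : ∀ i, 0 < p.γ i) {h : Fin KI → Fin M → ℂ}
    {g : Fin KE → Fin M → ℂ} (hk : ∀ i, ¬ KillsEigenvector (energyMatrix p g) (h i))
    {c β : ℝ} {l : Fin KI → ℝ} (hβ : 0 < β) (hl : ∀ i, 0 ≤ l i) (hc : c = 0 ∨ ∃ i, 0 < l i)
    (hI : ∀ i, (dualI p h g c β l i).PosSemidef) :
    Function.Injective (dualE p h g c β l).mulVec := by
  rw [← coe_mulVecLin, injective_iff_map_eq_zero]
  intro x hx
  rw [mulVecLin_apply] at hx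
  have hlx : ∀ k, l k ≠ 0 → h k ⬝ᵥ x = 0 := by
    intro k hlk
    have h1 := (Complex.le_def.1 ((hI k).dotProduct_mulVec_nonneg x)).1
    rw [dualI, sub_mulVec, hx, zero_sub, smul_mulVec, dotProduct_neg, dotProduct_smul,
      star_dotProduct_gram_mulVec, smul_eq_mul, ← Complex.ofReal_mul, Complex.neg_re,
      Complex.ofReal_re, Complex.zero_re] at h1
    have h2 : 0 < l k * (1 / p.γ k + 1) := by
      have := hγ k
      have := lt_of_le_of_ne (hl k) (Ne.symm hlk)
      positivity
    have h3 : ‖h k ⬝ᵥ x‖ ^ 2 ≤ 0 := by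
      by_contra! h4
      linarith [mul_pos h2 h4]
    exact norm_eq_zero.1 (pow_eq_zero_iff two_ne_zero |>.1 (le_antisymm h3 (by positivity)))
  rw [dualE_mulVec, Finset.sum_eq_zero, add_zero, sub_eq_zero] at hx
  · by_contra hx0
    have hβ' : (β : ℂ) ≠ 0 := by exact_mod_cast hβ.ne'
    have hc0 : (c : ℂ) ≠ 0 := by
      intro h0
      rw [h0, zero_smul] at hx
      exact (smul_ne_zero hβ' hx0) hx
    obtain ⟨i, hi⟩ := hc.resolve_left fun h0 => hc0 (by rw [h0]; simp)
    refine hk i ⟨β / c, div_ne_zero hβ' hc0, x, hx0, ?_, hlx i hi.ne'⟩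
    rw [div_eq_inv_mul, mul_smul, hx, smul_smul, inv_mul_cancel₀ hc0, one_smul]
  · intro k _
    by_cases h0 : l k = 0
    · simp [h0]
    · simp [hlx k h0]

/-- With all SINR multipliers zero, complementary slackness puts every column of `Wᵢ` in the
eigenspace of `G` at `β / c`. Simplicity gives `Wᵢ = tr(Wᵢ) v vᴴ`, so the traces serve as powers;
dropping `W_E` only relaxes the constraints. -/
lemma oeBFFeasible_of_multipliers {p : Params KI KE} (hP : 0 < p.P) (hσ : ∀ i, 0 < p.σ i)
    (hγ : ∀ i, 0 < p.γ i) {h : Fin KI → Fin M → ℂ} {g : Fin KE → Fin M → ℂ}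
    (hs : SimpleNonzeroSpectrum (energyMatrix p g))
    {X : (Fin KI → Matrix (Fin M) (Fin M) ℂ) × Matrix (Fin M) (Fin M) ℂ}
    (hX : X ∈ sdr1Feasible p h) {c β : ℝ} (hβ : 0 < β) (hc : 0 < c)
    (hobj : c * sdr1Objective p g X = β * p.P) (hE : (dualE p h g c β 0).PosSemidef)
    (hXE : dualE p h g c β 0 * X.2 = 0) (hXI : ∀ i, dualE p h g c β 0 * X.1 i = 0) :
    OeBFFeasible p h g := by
  have hβ' : (β : ℂ) ≠ 0 := by exact_mod_cast hβ.ne'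
  have hc' : (c : ℂ) ≠ 0 := by exact_mod_cast hc.ne'
  have hD : ∀ x, dualE p h g c β 0 *ᵥ x = (β : ℂ) • x - (c : ℂ) • (energyMatrix p g *ᵥ x) := by
    intro x
    rw [dualE_mulVec]
    simp
  have heig : ∀ Y : Matrix (Fin M) (Fin M) ℂ, dualE p h g c β 0 * Y = 0 →
      ∀ m, energyMatrix p g *ᵥ Y.col m = ((β / c : ℝ) : ℂ) • Y.col m := by
    intro Y hY m
    have h1 : dualE p h g c β 0 *ᵥ Y.col m = 0 := by
      funext k
      exact congrFun (congrFun hY k) m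
    rw [hD, sub_eq_zero] at h1
    rw [Complex.ofReal_div, div_eq_inv_mul, mul_smul, h1, smul_smul, inv_mul_cancel₀ hc', one_smul]
  -- Were `β / c` not an eigenvalue, all blocks of `X` would vanish, contradicting the objective
  -- value `β P / c > 0`.
  obtain ⟨y, hy0, hy⟩ : ∃ y : Fin M → ℂ, y ≠ 0 ∧
      energyMatrix p g *ᵥ y = ((β / c : ℝ) : ℂ) • y := by
    by_contra! hcon
    have hz : ∀ Y : Matrix (Fin M) (Fin M) ℂ, dualE p h g c β 0 * Y = 0 → Y = 0 := by
      intro Y hY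
      ext k m
      have : Y.col m = 0 := by
        by_contra h0
        exact hcon _ h0 (heig Y hY m)
      exact congrFun this k
    have : sdr1Objective p g X = 0 := by
      simp [sdr1Objective, hz _ hXE, fun i => hz _ (hXI i)]
    rw [this, mul_zero] at hobj
    exact (mul_pos hβ hP).ne hobj
  have hyn := sqNorm_pos hy0
  obtain ⟨v, hv0, hv1, hv⟩ : ∃ v : Fin M → ℂ, v ≠ 0 ∧ sqNorm v = 1 ∧
      energyMatrix p g *ᵥ v = ((β / c : ℝ) : ℂ) • v := by
    have hr : 0 < Real.sqrt (sqNorm y) := Real.sqrt_pos.2 hyn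
    refine ⟨(((Real.sqrt (sqNorm y))⁻¹ : ℝ) : ℂ) • y, ?_, ?_, ?_⟩
    · exact smul_ne_zero (by exact_mod_cast (inv_pos.2 hr).ne') hy0
    · have : sqNorm ((((Real.sqrt (sqNorm y))⁻¹ : ℝ) : ℂ) • y) =
          ((Real.sqrt (sqNorm y))⁻¹) ^ 2 * sqNorm y := by
        simp only [sqNorm, Pi.smul_apply, smul_eq_mul, norm_mul, mul_pow, ← Finset.mul_sum,
          Complex.norm_real, Real.norm_eq_abs, sq_abs]
      rw [this, inv_pow, Real.sq_sqrt hyn.le, inv_mul_cancel₀ hyn.ne']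
    · rw [mulVec_smul, hy, smul_comm]
  have hXv : ∀ i, X.1 i = (X.1 i).trace • outer v := fun i =>
    eq_trace_smul_outer (hX.2.2.1 i).isHermitian hv1 fun m =>
      hs _ (by exact_mod_cast (div_pos hβ hc).ne') v _ hv0 hv (heig _ (hXI i) m)
  have htr : ∀ i (u : Fin M → ℂ),
      (gram u * X.1 i).trace.re = (X.1 i).trace.re * ‖u ⬝ᵥ v‖ ^ 2 := by
    intro i u
    have him : (X.1 i).trace = ((X.1 i).trace.re : ℂ) :=
      Complex.ext rfl (Complex.le_def.1 (hX.2.2.1 i).trace_nonneg).2.symm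
    conv_lhs => rw [hXv i, him]
    rw [Matrix.mul_smul, trace_smul, smul_eq_mul, Complex.re_ofReal_mul, trace_gram_mul_outer_re]
  have htr0 : ∀ i, 0 ≤ (X.1 i).trace.re := fun i =>
    (Complex.le_def.1 (hX.2.2.1 i).trace_nonneg).1
  refine ⟨v, ⟨hv1, β / c, hv, fun ν hν => ?_⟩, fun i => (X.1 i).trace.re, htr0, fun i => ?_, ?_⟩
  -- Maximality of `β / c` is `β I - c G ⪰ 0` tested on an eigenvector.
  · obtain ⟨x, hx, hx0⟩ := hν.exists_hasEigenvector
    have hxG : energyMatrix p g *ᵥ x = (ν : ℂ) • x := by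
      simpa using Module.End.mem_eigenspace_iff.1 hx
    have h1 := (Complex.le_def.1 (hE.dotProduct_mulVec_nonneg x)).1
    rw [hD, hxG, smul_smul, ← sub_smul, dotProduct_smul, star_dotProduct_self_eq_sqNorm,
      smul_eq_mul, ← Complex.ofReal_mul, ← Complex.ofReal_sub, ← Complex.ofReal_mul,
      Complex.ofReal_re, Complex.zero_re] at h1
    have h2 := nonneg_of_mul_nonneg_left h1 (sqNorm_pos hx0)
    rw [le_div_iff₀ hc]
    linarith
  · have h1 := hX.1 i
    have h3 := trace_mul_re_nonneg (posSemidef_gram (h i)) hX.2.2.2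
    simp only [htr] at h1
    have h4 : 0 ≤ ∑ k ∈ Finset.univ.erase i, (X.1 k).trace.re * ‖h i ⬝ᵥ v‖ ^ 2 :=
      Finset.sum_nonneg fun k _ => mul_nonneg (htr0 k) (by positivity)
    have h5 := pow_pos (hσ i) 2
    rw [le_div_iff₀ (by linarith), mul_comm, ← le_div_iff₀ (hγ i)]
    linarith
  · have h1 := hX.2.1
    have h2 := (Complex.le_def.1 hX.2.2.2.trace_nonneg).1
    rw [Complex.zero_re] at h2
    linarith

lemma optimal_structure {p : Params KI KE} (hP : 0 < p.P) (hζ : 0 < p.ζ) (hσ : ∀ i, 0 < p.σ i)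
    (hγ : ∀ i, 0 < p.γ i) (hα : ∀ j, 0 ≤ p.α j) (hα' : ∃ j, 0 < p.α j)
    {h : Fin KI → Fin M → ℂ} {g : Fin KE → Fin M → ℂ}
    (hs : SimpleNonzeroSpectrum (energyMatrix p g))
    (hk : ∀ i, ¬ KillsEigenvector (energyMatrix p g) (h i)) (hg : ∀ j, g j ≠ 0)
    (hO : ¬ OeBFFeasible p h g)
    {X : (Fin KI → Matrix (Fin M) (Fin M) ℂ) × Matrix (Fin M) (Fin M) ℂ}
    (hX : IsSDR1Optimal p h g X) :
    X.2 = 0 ∧ ∀ i, ∃ a b, X.1 i = vecMulVec a b := by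
  obtain ⟨c, β, l, hc, hβ, hl, hne, hval, hE, hI, hXE, hXI⟩ := exists_multipliers hX
  have hobj := sdr1Objective_nonneg hζ.le hα g hX.1
  have hlσ : ∀ i, 0 ≤ l i * p.σ i ^ 2 := fun i => mul_nonneg (hl i) (by positivity)
  have hlσs : 0 ≤ ∑ i, l i * p.σ i ^ 2 := Finset.sum_nonneg fun i _ => hlσ i
  have hβpos : 0 < β := by
    refine lt_of_le_of_ne hβ fun h0 => ?_
    subst h0
    have hl0 : l = 0 := by
      have h1 : ∑ i, l i * p.σ i ^ 2 = 0 := by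
        have := mul_nonneg hc hobj
        linarith
      funext i
      have h2 := (Finset.sum_eq_zero_iff_of_nonneg fun i _ => hlσ i).1 h1 i (Finset.mem_univ i)
      exact (mul_eq_zero.1 h2).resolve_right (pow_pos (hσ i) 2).ne'
    have hcpos : 0 < c := by
      rcases hne with h1 | h1 | ⟨i, h1⟩
      · exact h1
      · exact absurd h1 (lt_irrefl _)
      · rw [hl0] at h1
        exact absurd h1 (lt_irrefl _)
    obtain ⟨x, hx⟩ := energyMatrix_quadraticForm_pos hζ hα hα' hg
    have h1 := (Complex.le_def.1 (hE.dotProduct_mulVec_nonneg x)).1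
    rw [dualE_mulVec, hl0] at h1
    simp only [Complex.ofReal_zero, zero_smul, Pi.zero_apply, zero_mul, Finset.sum_const_zero,
      add_zero, zero_sub, dotProduct_neg, dotProduct_smul, smul_eq_mul, Complex.neg_re,
      Complex.re_ofReal_mul, Complex.zero_re] at h1
    linarith [mul_pos hcpos hx]
  have hcl : c = 0 ∨ ∃ i, 0 < l i := by
    by_contra! hcon
    have hl0 : l = 0 := funext fun i => le_antisymm (hcon.2 i) (hl i)
    subst hl0
    refine hO (oeBFFeasible_of_multipliers hP hσ hγ hs hX.1 hβpos
      (lt_of_le_of_ne hc hcon.1.symm) (by simpa using hval) hE hXE fun i => ?_)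
    simpa [dualI] using hXI i
  have hinj := dualE_mulVec_injective hγ hk hβpos hl hcl hI
  have hunit : IsUnit (dualE p h g c β l).det :=
    (isUnit_iff_isUnit_det _).1 (mulVec_injective_iff_isUnit.1 hinj)
  refine ⟨?_, fun i => ?_⟩
  · rw [← nonsing_inv_mul_cancel_left _ X.2 hunit, hXE, mul_zero]
  · have h1 := hXI i
    rw [dualI, sub_mul, sub_eq_zero, smul_mul, gram, vecMulVec_mul, ← smul_vecMulVec] at h1
    have h2 := nonsing_inv_mul_cancel_left _ (X.1 i) hunit
    rw [h1, mul_vecMulVec] at h2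
    exact ⟨_, _, h2.symm⟩

/-! ### Existence of an optimal point -/

lemma isClosed_posSemidef : IsClosed {W : Matrix (Fin M) (Fin M) ℂ | W.PosSemidef} := by
  have h1 : IsClosed {W : Matrix (Fin M) (Fin M) ℂ | Wᴴ = W} :=
    isClosed_eq continuous_id.matrix_conjTranspose continuous_id
  have h2 : IsClosed (⋂ x : Fin M → ℂ,
      {W : Matrix (Fin M) (Fin M) ℂ | 0 ≤ (star x ⬝ᵥ W *ᵥ x).re}) :=
    isClosed_iInter fun x => isClosed_le continuous_const (Complex.continuous_re.comp
      (continuous_const.dotProduct (continuous_id.matrix_mulVec continuous_const)))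
  convert h1.inter h2 using 1
  ext W
  simp only [Set.mem_ofPred_eq, Set.mem_inter_iff, Set.mem_iInter]
  exact ⟨fun hW => ⟨hW.isHermitian, fun x => (Complex.le_def.1 (hW.dotProduct_mulVec_nonneg x)).1⟩,
    fun hW => posSemidef_of_re_nonneg hW.1 hW.2⟩

/-- For `W = BᴴB` the trace is the squared Frobenius norm of `B`, and `ab ≤ (a² + b²)/2` bounds each
entry. Hence the power budget bounds the feasible set. -/
lemma norm_entry_le_trace {W : Matrix (Fin M) (Fin M) ℂ} (hW : W.PosSemidef) (k l : Fin M) :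
    ‖W k l‖ ≤ W.trace.re := by
  obtain ⟨B, rfl⟩ := exists_eq_conjTranspose_mul_self hW
  have htr : (Bᴴ * B).trace.re = ∑ m, ∑ j, ‖B m j‖ ^ 2 := by
    rw [Finset.sum_comm]
    simp only [trace, diag_apply, mul_apply, conjTranspose_apply, Complex.re_sum]
    refine Finset.sum_congr rfl fun j _ => Finset.sum_congr rfl fun m _ => ?_
    rw [← Complex.normSq_eq_norm_sq, ← Complex.ofReal_re (Complex.normSq _), ← Complex.mul_conj,
      mul_comm]
    rfl
  rw [htr, mul_apply]
  refine (norm_sum_le _ _).trans (Finset.sum_le_sum fun m _ => ?_)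
  rw [conjTranspose_apply, norm_mul, norm_star]
  have h1 : ∀ j, ‖B m j‖ ^ 2 ≤ ∑ j, ‖B m j‖ ^ 2 := fun j =>
    Finset.single_le_sum (f := fun j => ‖B m j‖ ^ 2) (fun j _ => by positivity) (Finset.mem_univ j)
  nlinarith [h1 k, h1 l, sq_nonneg (‖B m k‖ - ‖B m l‖)]

lemma continuous_trace_mul_re (A : Matrix (Fin M) (Fin M) ℂ) :
    Continuous fun W : Matrix (Fin M) (Fin M) ℂ => (A * W).trace.re :=
  Complex.continuous_re.comp (continuous_const.matrix_mul continuous_id).matrix_trace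

lemma continuous_trace_re : Continuous fun W : Matrix (Fin M) (Fin M) ℂ => W.trace.re :=
  Complex.continuous_re.comp continuous_id.matrix_trace

lemma isCompact_sdr1Feasible (p : Params KI KE) (h : Fin KI → Fin M → ℂ) :
    IsCompact (sdr1Feasible p h) := by
  let T : Set (Matrix (Fin M) (Fin M) ℂ) :=
    Set.univ.pi fun _ => Set.univ.pi fun _ => Metric.closedBall 0 p.P
  have hT : IsCompact T :=
    isCompact_univ_pi fun _ => isCompact_univ_pi fun _ => isCompact_closedBall 0 p.P
  have hS : IsCompact ((Set.univ.pi fun _ : Fin KI => T) ×ˢ T) :=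
    (isCompact_univ_pi fun _ => hT).prod hT
  refine hS.of_isClosed_subset ?_ ?_
  · have hfst : ∀ i, Continuous fun X : (Fin KI → Matrix (Fin M) (Fin M) ℂ) ×
        Matrix (Fin M) (Fin M) ℂ => X.1 i := fun i => (continuous_apply i).comp continuous_fst
    have h1 : IsClosed {X : (Fin KI → Matrix (Fin M) (Fin M) ℂ) × Matrix (Fin M) (Fin M) ℂ |
        ∀ i, 0 ≤ sinrSlack p h X i} := by
      simp only [Set.ofPred_forall]
      refine isClosed_iInter fun i => isClosed_le continuous_const ?_
      exact ((((continuous_trace_mul_re _).comp (hfst i)).div_const _).sub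
        (continuous_finsetSum _ fun k _ => (continuous_trace_mul_re _).comp (hfst k))).sub
        ((continuous_trace_mul_re _).comp continuous_snd) |>.sub continuous_const
    have h2 : IsClosed {X : (Fin KI → Matrix (Fin M) (Fin M) ℂ) × Matrix (Fin M) (Fin M) ℂ |
        power X ≤ p.P} :=
      isClosed_le ((continuous_finsetSum _ fun i _ => continuous_trace_re.comp (hfst i)).add
        (continuous_trace_re.comp continuous_snd)) continuous_const
    have h3 : IsClosed {X : (Fin KI → Matrix (Fin M) (Fin M) ℂ) × Matrix (Fin M) (Fin M) ℂ |
        ∀ i, (X.1 i).PosSemidef} := by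
      simp only [Set.ofPred_forall]
      exact isClosed_iInter fun i => isClosed_posSemidef.preimage (hfst i)
    have h4 : IsClosed {X : (Fin KI → Matrix (Fin M) (Fin M) ℂ) × Matrix (Fin M) (Fin M) ℂ |
        X.2.PosSemidef} := isClosed_posSemidef.preimage continuous_snd
    exact h1.inter (h2.inter (h3.inter h4))
  · rintro X ⟨-, hp, h1, h2⟩
    have ht1 : ∀ i, 0 ≤ (X.1 i).trace.re := fun i => (Complex.le_def.1 (h1 i).trace_nonneg).1
    have ht2 : 0 ≤ X.2.trace.re := (Complex.le_def.1 h2.trace_nonneg).1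
    have hle1 : ∀ i, (X.1 i).trace.re ≤ p.P := fun i => by
      have := Finset.single_le_sum (f := fun i => (X.1 i).trace.re) (fun i _ => ht1 i)
        (Finset.mem_univ i)
      linarith
    have hle2 : X.2.trace.re ≤ p.P := by
      have := Finset.sum_nonneg fun (i : Fin KI) (_ : i ∈ Finset.univ) => ht1 i
      linarith
    refine ⟨fun i _ k _ l _ => ?_, fun k _ l _ => ?_⟩
    · exact mem_closedBall_zero_iff.2 ((norm_entry_le_trace (h1 i) k l).trans (hle1 i))
    · exact mem_closedBall_zero_iff.2 ((norm_entry_le_trace h2 k l).trans hle2)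

lemma continuous_sdr1Objective (p : Params KI KE) (g : Fin KE → Fin M → ℂ) :
    Continuous (sdr1Objective p g) :=
  (continuous_finsetSum _ fun i _ => (continuous_trace_mul_re _).comp
    ((continuous_apply i).comp continuous_fst)).add ((continuous_trace_mul_re _).comp continuous_snd)

lemma exists_isSDR1Optimal (p : Params KI KE) {h : Fin KI → Fin M → ℂ} (g : Fin KE → Fin M → ℂ)
    (hne : (sdr1Feasible p h).Nonempty) : ∃ X, IsSDR1Optimal p h g X := by
  obtain ⟨X, hX, hmax⟩ := (isCompact_sdr1Feasible p h).exists_isMaxOn hne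
    (continuous_sdr1Objective p g).continuousOn
  exact ⟨X, hX, hmax⟩

/-! ### Passage between the beamforming problem and its relaxation -/

/-- The point of the relaxation attached to a choice of beams. -/
noncomputable def lift (x : (Fin KI → Fin M → ℂ) × (Fin KE → Fin M → ℂ)) :
    (Fin KI → Matrix (Fin M) (Fin M) ℂ) × Matrix (Fin M) (Fin M) ℂ :=
  (fun i => outer (x.1 i), ∑ j, outer (x.2 j))

lemma sdr1Objective_lift (p : Params KI KE) (g : Fin KE → Fin M → ℂ)
    (x : (Fin KI → Fin M → ℂ) × (Fin KE → Fin M → ℂ)) :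
    sdr1Objective p g (lift x) = p1Objective p g x := by
  simp only [sdr1Objective, lift, p1Objective, Finset.mul_sum, trace_sum, Complex.re_sum,
    trace_mul_outer]

lemma lift_mem_sdr1Feasible_iff {p : Params KI KE} (hσ : ∀ i, 0 < p.σ i) (hγ : ∀ i, 0 < p.γ i)
    (h : Fin KI → Fin M → ℂ) (x : (Fin KI → Fin M → ℂ) × (Fin KE → Fin M → ℂ)) :
    lift x ∈ sdr1Feasible p h ↔ x ∈ p1Feasible p h := by
  have hpow : ∑ i, ((lift x).1 i).trace.re + (lift x).2.trace.re =
      ∑ i, sqNorm (x.1 i) + ∑ j, sqNorm (x.2 j) := by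
    simp only [lift, trace_sum, Complex.re_sum, trace_outer_re]
  have hsinr : ∀ i, 0 ≤ sinrSlack p h (lift x) i ↔ p.γ i ≤ sinrI p h x i := by
    intro i
    have h1 : 0 ≤ ∑ k ∈ Finset.univ.erase i, ‖h i ⬝ᵥ x.1 k‖ ^ 2 :=
      Finset.sum_nonneg fun k _ => by positivity
    have h2 : 0 ≤ ∑ j, ‖h i ⬝ᵥ x.2 j‖ ^ 2 := Finset.sum_nonneg fun k _ => by positivity
    have h3 := pow_pos (hσ i) 2
    rw [sinrI, le_div_iff₀ (by linarith), mul_comm, ← le_div_iff₀ (hγ i)]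
    simp only [sinrSlack, lift, Finset.mul_sum, trace_sum, Complex.re_sum, trace_gram_mul_outer_re]
    constructor <;> intro _ <;> linarith
  constructor
  · rintro ⟨hs, hp, -, -⟩
    exact ⟨fun i => (hsinr i).1 (hs i), hpow ▸ hp⟩
  · rintro ⟨hs, hp⟩
    exact ⟨fun i => (hsinr i).2 (hs i), hpow.trans_le hp, fun i => posSemidef_outer _,
      posSemidef_sum _ fun j _ => posSemidef_outer _⟩

/-- Lifting preserves feasibility and objective, so no choice of beams can beat a relaxed optimum
that is itself a lift. -/
lemma isP1Optimal_of_lift {p : Params KI KE} (hσ : ∀ i, 0 < p.σ i) (hγ : ∀ i, 0 < p.γ i)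
    {h : Fin KI → Fin M → ℂ} {g : Fin KE → Fin M → ℂ}
    {x : (Fin KI → Fin M → ℂ) × (Fin KE → Fin M → ℂ)} (hx : IsSDR1Optimal p h g (lift x)) :
    IsP1Optimal p h g x := by
  refine ⟨(lift_mem_sdr1Feasible_iff hσ hγ h x).1 hx.1, fun y hy => ?_⟩
  have : sdr1Objective p g (lift y) ≤ sdr1Objective p g (lift x) :=
    hx.2 ((lift_mem_sdr1Feasible_iff hσ hγ h y).2 hy)
  simp only [sdr1Objective_lift] at this
  exact this

end SWIPT

theorem proposition3p1 {M KI KE : ℕ} (hM : 1 < M) (p : SWIPT.Params KI KE)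
    (hP : 0 < p.P) (hζ : 0 < p.ζ ∧ p.ζ ≤ 1) (hσ : ∀ i, 0 < p.σ i) (hγ : ∀ i, 0 < p.γ i)
    (hα : ∀ j, 0 ≤ p.α j) (hα' : ∃ j, 0 < p.α j)
    {Ω : Type*} [MeasurableSpace Ω] (μ : MeasureTheory.Measure Ω)
    [MeasureTheory.IsProbabilityMeasure μ]
    (h : Fin KI → Ω → Fin M → ℂ) (g : Fin KE → Ω → Fin M → ℂ)
    (hchan : SWIPT.IndependentChannels μ h g) :
    ∀ᵐ ω ∂μ,
      (SWIPT.sdr1Feasible p (fun i => h i ω)).Nonempty →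
      ¬ SWIPT.OeBFFeasible p (fun i => h i ω) (fun j => g j ω) →
      (∃ X, SWIPT.IsSDR1Optimal p (fun i => h i ω) (fun j => g j ω) X) ∧
      ∀ X, SWIPT.IsSDR1Optimal p (fun i => h i ω) (fun j => g j ω) X →
        (∀ i, (X.1 i).rank = 1) ∧ X.2 = 0 ∧
        ∃ w : Fin KI → Fin M → ℂ, (∀ i, X.1 i = SWIPT.outer (w i)) ∧
          SWIPT.IsP1Optimal p (fun i => h i ω) (fun j => g j ω) (w, 0) ∧
          SWIPT.p1Objective p (fun j => g j ω) (w, 0) =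
            SWIPT.sdr1Objective p (fun j => g j ω) X := by
  filter_upwards [SWIPT.ae_generic p hM hchan] with ω hω hne hO
  obtain ⟨hs, hk, hg⟩ := hω
  refine ⟨SWIPT.exists_isSDR1Optimal p _ hne, fun X hX => ?_⟩
  obtain ⟨hX2, hX1⟩ := SWIPT.optimal_structure hP hζ.1 hσ hγ hα hα' hs hk hg hO hX
  have hout : ∀ i, ∃ w, X.1 i = SWIPT.outer w := fun i => by
    obtain ⟨a, b, hab⟩ := hX1 i
    exact SWIPT.exists_eq_outer_of_vecMulVec (hX.1.2.2.1 i) a b hab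
  choose w hw using hout
  have hlift : X = SWIPT.lift (w, (0 : Fin KE → Fin M → ℂ)) := by
    refine Prod.ext (funext hw) ?_
    simp [SWIPT.lift, SWIPT.outer, hX2]
  refine ⟨fun i => le_antisymm ?_ ?_, hX2, w, hw, ?_, ?_⟩
  · rw [hw i]
    exact Matrix.rank_vecMulVec_le _ _
  · rw [Nat.one_le_iff_ne_zero, Matrix.rank, Ne, Submodule.finrank_eq_zero, LinearMap.range_eq_bot]
    exact fun h0 => SWIPT.sdr1Feasible_ne_zero hσ hX.1 i
      (Matrix.toLin'.map_eq_zero_iff.1 (by rw [← h0]; rfl))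
  · exact SWIPT.isP1Optimal_of_lift hσ hγ (hlift ▸ hX)
  · rw [hlift, SWIPT.sdr1Objective_lift]
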